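/- Let $\mathcal X,\mathcal Y$ be measurable spaces and let $P$ (source) and $Q$ (target) be probability distributions on $\mathcal X\times\mathcal Y$ satisfying covariate shift: they have a common conditional distribution of $y$ given $x$. Let $p,q\ge 0$ be the (finite) densities of the marginals $P_X,Q_X$ with respect to a common measure on $\mathcal X$, with $q(x)=0$ wherever $p(x)=0$; let $w^*(x)=q(x)/p(x)$ (with $w^*(x)=0$ if $p(x)=q(x)=0$), and let $b\in\mathbb R$ satisfy $w^*(x)\le b$ for all $x$. Let $f:\mathcal X\times\mathcal Y\to\mathbb R_{\ge0}$ be measurable, $C_\tau(x)=\{y: f(x,y)\ge\tau\}$ for $\tau\ge0$, and $L_Q(C)=\Pr_{(x,y)\sim Q}[y\notin C(x)]$. Let $\varepsilon,\delta_C,\delta_w\in(0,1)$ and $m,n\ge 0$. Let $S_m=((x_i,y_i))_{i\le m}\sim P^m$, $V=(V_i)_{i\le m}\sim\mathrm{Uniform}([0,1])^m$ and $T_n^X\sim Q_X^n$ be independent, and let $S_m^X=(x_i)_{i\le m}$. For $k,N\in\mathbb N$ put $F(k;N,\theta)=\sum_{i=0}^{k}\binom{N}{i}\theta^i(1-\theta)^{N-i}$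 and $$\overline\theta(k;N,\delta)=\inf\big(\{\theta\in[0,1]: F(k;N,\theta)\le\delta\}\cup\{1\}\big).$$ For $w\in\mathbb R^m$ put $U_{\mathrm{RSCP}}(C,S_m,V,w,b,\delta)=\overline\theta(k;N,\delta)$, where $N=\#\{i: V_i\le w_i/b\}$ and $k=\#\{i: V_i\le w_i/b,\ y_i\notin C(x_i)\}$. Let $\underline w,\overline w\in\mathbb R^m$ be measurable functions of $(S_m^X,T_n^X)$ such that the box $\mathcal W=\{w\in\mathbb R^m:\underline w_i\le w_i\le\overline w_i\ \forall i\}$ satisfies $$\Pr_{S_m^X\sim P_X^m,\,T_n^X\sim Q_X^n}\big[(w^*(x_1),\dots,w^*(x_m))\in\mathcal W\big]\ge 1-\delta_w .$$ For $\tau\ge0$ let $\hat w_\tau\in\mathbb R^m$ have $i$-th coordinate $\overline w_i$ if $y_i\notin C_\tau(x_i)$ and $\underline w_i$ if $y_i\in C_\tau(x_i)$, and let $$\hat\tau=\max\{\tau\ge0:\ U_{\mathrm{RSCP}}(C_\tau,S_m,V,\hat w_\tau,b,\delta_C)\le\varepsilon\},$$ with $\hat\tau=0$ if no such $\tau$ exists.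 Then this maximum is attained whenever the set is nonempty, and $$\Pr_{S_m\sim P^m,\,V\sim \mathrm{Uniform}([0,1])^m,\,T_n^X\sim Q_X^n}\big[L_Q(C_\tau)\le\varepsilon\ \text{ for all } 0\le\tau\le\hat\tau\big]\ \ge\ 1-\delta_C-\delta_w .$$ -/

import Mathlib

open MeasureTheory ProbabilityTheory
open scoped NNReal ENNReal

noncomputable section

namespace CovShift

variable {X Y : Type*}

/-- The prediction set `C_τ(x) = {y | f(x, y) ≥ τ}`. -/
def predSet (f : X × Y → ℝ≥0) (τ : ℝ≥0) (x : X) : Set Y := {y | τ ≤ f (x, y)}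

/-- The expected error `L_Q(C) = ℙ_{(x, y) ∼ Q}[y ∉ C(x)]`. -/
def expectedError [MeasurableSpace X] [MeasurableSpace Y] (Q : Measure (X × Y))
    (C : X → Set Y) : ℝ :=
  Q.real {z | z.2 ∉ C z.1}

/-- The binomial CDF `F(k; m, θ)`. -/
def binomCDF (k m : ℕ) (θ : ℝ) : ℝ :=
  ∑ i ∈ Finset.range (k + 1), (m.choose i : ℝ) * θ ^ i * (1 - θ) ^ (m - i)

/-- The Clopper-Pearson upper bound `inf ({θ ∈ [0, 1] | F(k; m, θ) ≤ δ} ∪ {1})`. -/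
def cpUpper (k m : ℕ) (δ : ℝ) : ℝ :=
  sInf ({θ : ℝ | θ ∈ Set.Icc 0 1 ∧ binomCDF k m θ ≤ δ} ∪ {1})

open Classical in
/-- The number of errors of `C` on a finite sample (repeated examples count repeatedly). -/
def errorCount (C : X → Set Y) (T : Multiset (X × Y)) : ℕ :=
  T.countP (fun z => z.2 ∉ C z.1)

/-- The bound `U_CP(C, T, δ)`. -/
def uCP (C : X → Set Y) (T : Multiset (X × Y)) (δ : ℝ) : ℝ :=
  cpUpper (errorCount C T) T.card δ

open Classical in
/-- The examples `(x_i, y_i)` accepted by rejection sampling, i.e. those with `V_i ≤ w_i / b`. -/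
def acceptedSample {m : ℕ} (S : Fin m → X × Y) (V w : Fin m → ℝ) (b : ℝ) : Multiset (X × Y) :=
  (Finset.univ.filter (fun i => V i ≤ w i / b)).val.map S

/-- The rejection-sampling Clopper-Pearson bound `U_RSCP(C, S, V, w, b, δ)`. -/
def uRSCP {m : ℕ} (C : X → Set Y) (S : Fin m → X × Y) (V w : Fin m → ℝ) (b δ : ℝ) : ℝ :=
  uCP C (acceptedSample S V w b) δ

/-- The uncertainty box `{w | ∀ i, lo_i ≤ w_i ≤ hi_i}`. -/
def uncertaintyBox {m : ℕ} (lo hi : Fin m → ℝ) : Set (Fin m → ℝ) :=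
  {w | ∀ i, lo i ≤ w i ∧ w i ≤ hi i}

open Classical in
/-- The greedy weights: the upper weight on errors of `C`, the lower weight on non-errors. -/
def greedyWeights {m : ℕ} (C : X → Set Y) (S : Fin m → X × Y) (lo hi : Fin m → ℝ) :
    Fin m → ℝ :=
  fun i => if (S i).2 ∉ C (S i).1 then hi i else lo i

/-- The thresholds `τ ≥ 0` at which the RSCP bound, evaluated at the greedy weights, is `≤ ε`. -/
def feasible {m : ℕ} (f : X × Y → ℝ≥0) (S : Fin m → X × Y) (V lo hi : Fin m → ℝ)
    (b δ ε : ℝ) : Set ℝ≥0 :=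
  {τ | uRSCP (predSet f τ) S V (greedyWeights (predSet f τ) S lo hi) b δ ≤ ε}

/-- The selected threshold: the largest feasible one, and `0` if there is none. (The supremum of
`∅` in `ℝ≥0` is `0`.) -/
def tauHat {m : ℕ} (f : X × Y → ℝ≥0) (S : Fin m → X × Y) (V lo hi : Fin m → ℝ)
    (b δ ε : ℝ) : ℝ≥0 :=
  sSup (feasible f S V lo hi b δ ε)

/-- The importance weight `w*(x) = q(x) / p(x)`. -/
def importanceWeight (p q : X → ℝ≥0) (x : X) : ℝ := (q x : ℝ) / (p x : ℝ)

/-- The uniform distribution on `[0, 1]`. -/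
def uniform01 : Measure ℝ := volume.restrict (Set.Icc 0 1)

/-- The joint law of the labeled source sample `S ∼ P^m`, the uniforms `V ∼ U^m` and the
unlabeled target sample `T ∼ Q_X^n`, all independent. -/
def dataLaw [MeasurableSpace X] [MeasurableSpace Y] (P Q : Measure (X × Y)) (m n : ℕ) :
    Measure ((Fin m → X × Y) × (Fin m → ℝ) × (Fin n → X)) :=
  (Measure.pi fun _ : Fin m => P).prod
    ((Measure.pi fun _ : Fin m => uniform01).prod (Measure.pi fun _ : Fin n => Q.fst))

end CovShift

end

/-!
A threshold `τ ≤ τ̂` is invalid when `Q {z | f z < τ}` exceeds `ε`. All the sublevel sets of mass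
greater than `ε` share one fixed measurable subset `E` of mass `θ ≥ ε`, so it is enough to control a
single test, and no union bound over `τ` is needed: under the true weights, the accepted examples
are i.i.d. from `Q`, so the number of them in `E` is binomial with parameter `θ`, and the event
`F(k; N, θ) ≤ δC` has probability at most `δC`. Suppose the box contains the true weights and some
`τ ≤ τ̂` is invalid. The greedy weights maximize the bound over the box and errors at `τ̂` include
the sample points in `E`, so feasibility of `τ̂` forces that event.
-/

namespace CovShift

open scoped Finset

section BinomialCDF

theorem binomCDF_zero_left (N : ℕ) (θ : ℝ) : binomCDF 0 N θ = (1 - θ) ^ N := by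
  simp [binomCDF]

theorem binomCDF_zero_right (k : ℕ) (θ : ℝ) : binomCDF k 0 θ = 1 := by
  simp [binomCDF, Finset.sum_range_succ']

theorem binomCDF_self (N : ℕ) (θ : ℝ) : binomCDF N N θ = 1 := by
  calc binomCDF N N θ = (θ + (1 - θ)) ^ N := by
        rw [add_pow]
        exact Finset.sum_congr rfl fun i _ => by ring
    _ = 1 := by rw [add_sub_cancel, one_pow]

theorem continuous_binomCDF (k N : ℕ) : Continuous (binomCDF k N) := by
  unfold binomCDF
  fun_prop

theorem choose_succ_mul_pow_mul_pow (i N : ℕ) (x y : ℝ) :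
    ((N + 1).choose (i + 1) : ℝ) * x ^ (i + 1) * y ^ (N + 1 - (i + 1)) =
      x * ((N.choose i : ℝ) * x ^ i * y ^ (N - i)) +
        y * ((N.choose (i + 1) : ℝ) * x ^ (i + 1) * y ^ (N - (i + 1))) := by
  rw [Nat.choose_succ_succ, Nat.add_sub_add_right]
  rcases Nat.lt_or_ge i N with hi | hi
  · obtain ⟨d, rfl⟩ := Nat.exists_eq_add_of_lt hi
    rw [show i + d + 1 - i = d + 1 by lia, show i + d + 1 - (i + 1) = d by lia]
    push_cast
    ring
  · rw [Nat.choose_eq_zero_of_lt (Nat.lt_succ_of_le hi)]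
    push_cast
    ring

theorem binomCDF_succ_succ (k N : ℕ) (θ : ℝ) :
    binomCDF (k + 1) (N + 1) θ = θ * binomCDF k N θ + (1 - θ) * binomCDF (k + 1) N θ := by
  simp only [binomCDF]
  rw [Finset.sum_range_succ', Finset.sum_range_succ' _ (k + 1), mul_add, Finset.mul_sum,
    Finset.mul_sum, ← add_assoc, ← Finset.sum_add_distrib]
  congr 1
  · exact Finset.sum_congr rfl fun i _ => choose_succ_mul_pow_mul_pow i N θ (1 - θ)
  · simp [pow_succ']

variable {θ : ℝ}

theorem binomCDF_le_succ_left (k N : ℕ) (hθ : θ ∈ Set.Icc (0 : ℝ) 1) :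
    binomCDF k N θ ≤ binomCDF (k + 1) N θ := by
  have h0 : 0 ≤ θ := hθ.1
  have h1 : 0 ≤ 1 - θ := sub_nonneg.2 hθ.2
  rw [binomCDF, binomCDF, Finset.sum_range_succ _ (k + 1)]
  exact le_add_of_nonneg_right (by positivity)

theorem monotone_binomCDF_left (N : ℕ) (hθ : θ ∈ Set.Icc (0 : ℝ) 1) :
    Monotone fun k => binomCDF k N θ :=
  monotone_nat_of_le_succ fun k => binomCDF_le_succ_left k N hθ

theorem binomCDF_le_succ_succ (k N : ℕ) (hθ : θ ∈ Set.Icc (0 : ℝ) 1) :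
    binomCDF k N θ ≤ binomCDF (k + 1) (N + 1) θ := by
  rw [binomCDF_succ_succ]
  nlinarith [binomCDF_le_succ_left k N hθ, hθ.2]

theorem binomCDF_succ_right_le (k N : ℕ) (hθ : θ ∈ Set.Icc (0 : ℝ) 1) :
    binomCDF k (N + 1) θ ≤ binomCDF k N θ := by
  cases k with
  | zero =>
    rw [binomCDF_zero_left, binomCDF_zero_left]
    exact pow_le_pow_of_le_one (sub_nonneg.2 hθ.2) (by linarith [hθ.1]) (Nat.le_succ N)
  | succ k =>
    rw [binomCDF_succ_succ]
    nlinarith [binomCDF_le_succ_left k N hθ, hθ.1]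

theorem binomCDF_add_le_binomCDF_add {k k' s s' : ℕ} (hk : k ≤ k') (hs : s' ≤ s)
    (hθ : θ ∈ Set.Icc (0 : ℝ) 1) :
    binomCDF k (k + s) θ ≤ binomCDF k' (k' + s') θ := by
  have hmono : Monotone fun j => binomCDF j (j + s) θ := monotone_nat_of_le_succ fun j => by
    rw [Nat.succ_add_eq_add_succ j s]
    exact binomCDF_le_succ_succ j (j + s) hθ
  have hanti : Antitone fun N => binomCDF k' N θ :=
    antitone_nat_of_succ_le fun N => binomCDF_succ_right_le k' N hθ
  exact (hmono hk).trans (hanti (Nat.add_le_add_left hs k'))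

theorem antitoneOn_binomCDF (k N : ℕ) : AntitoneOn (binomCDF k N) (Set.Icc 0 1) := by
  intro θ hθ θ' hθ' h
  induction N generalizing k with
  | zero => simp only [binomCDF_zero_right, le_refl]
  | succ N ih =>
    cases k with
    | zero =>
      rw [binomCDF_zero_left, binomCDF_zero_left]
      exact pow_le_pow_left₀ (sub_nonneg.2 hθ'.2) (by linarith) _
    | succ k =>
      rw [binomCDF_succ_succ, binomCDF_succ_succ]
      calc θ' * binomCDF k N θ' + (1 - θ') * binomCDF (k + 1) N θ'
          ≤ θ * binomCDF k N θ' + (1 - θ) * binomCDF (k + 1) N θ' := by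
            nlinarith [binomCDF_le_succ_left k N hθ']
        _ ≤ θ * binomCDF k N θ + (1 - θ) * binomCDF (k + 1) N θ :=
            add_le_add (mul_le_mul_of_nonneg_left (ih k) hθ.1)
              (mul_le_mul_of_nonneg_left (ih (k + 1)) (sub_nonneg.2 hθ.2))

end BinomialCDF

section ClopperPearson

theorem bddBelow_cpUpper (k N : ℕ) (δ : ℝ) :
    BddBelow ({θ : ℝ | θ ∈ Set.Icc 0 1 ∧ binomCDF k N θ ≤ δ} ∪ {1}) :=
  ⟨0, by rintro θ (hθ | rfl); exacts [hθ.1.1, zero_le_one]⟩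

theorem cpUpper_mem (k N : ℕ) (δ : ℝ) :
    cpUpper k N δ ∈ {θ : ℝ | θ ∈ Set.Icc 0 1 ∧ binomCDF k N θ ≤ δ} ∪ {1} :=
  ((isClosed_Icc.inter (isClosed_le (continuous_binomCDF k N) continuous_const)).union
    isClosed_singleton).csInf_mem ⟨1, Or.inr rfl⟩ (bddBelow_cpUpper k N δ)

theorem cpUpper_self (N : ℕ) {δ : ℝ} (hδ : δ < 1) : cpUpper N N δ = 1 := by
  rcases cpUpper_mem N N δ with ⟨-, hle⟩ | h
  · exact absurd (binomCDF_self N _ ▸ hle) hδ.not_ge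
  · exact h

theorem cpUpper_add_le_cpUpper_add {k k' s s' : ℕ} (hk : k ≤ k') (hs : s' ≤ s) (δ : ℝ) :
    cpUpper k (k + s) δ ≤ cpUpper k' (k' + s') δ :=
  csInf_le_csInf (bddBelow_cpUpper k (k + s) δ) ⟨1, Or.inr rfl⟩ <|
    Set.union_subset_union_left _ fun _ hθ =>
      ⟨hθ.1, (binomCDF_add_le_binomCDF_add hk hs hθ.1).trans hθ.2⟩

theorem binomCDF_le_of_cpUpper_le {k N : ℕ} {δ ε θ : ℝ} (h : cpUpper k N δ ≤ ε) (hε : ε < 1)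
    (hεθ : ε ≤ θ) (hθ : θ ≤ 1) : binomCDF k N θ ≤ δ := by
  rcases cpUpper_mem k N δ with ⟨hI, hle⟩ | h1
  · have hle_θ := h.trans hεθ
    exact (antitoneOn_binomCDF k N hI ⟨hI.1.trans hle_θ, hθ⟩ hle_θ).trans hle
  · exact absurd (h1.symm.trans_le h) hε.not_ge

end ClopperPearson

section ConditionalBinomialTest

theorem sum_choose_mul_filter_binomCDF_le (N : ℕ) {θ δ : ℝ} (hθ : θ ∈ Set.Icc (0 : ℝ) 1)
    (hδ : 0 ≤ δ) :
    ∑ j ∈ Finset.range (N + 1) with binomCDF j N θ ≤ δ,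
      (N.choose j : ℝ) * θ ^ j * (1 - θ) ^ (N - j) ≤ δ := by
  have h0 : 0 ≤ θ := hθ.1
  have h1 : 0 ≤ 1 - θ := sub_nonneg.2 hθ.2
  rcases ({j ∈ Finset.range (N + 1) | binomCDF j N θ ≤ δ}).eq_empty_or_nonempty with he | hne
  · rw [he, Finset.sum_empty]
    exact hδ
  · -- The sum is at most the distribution function at the largest index that occurs in it.
    refine le_trans ?_ (Finset.mem_filter.1 (Finset.max'_mem _ hne)).2
    refine Finset.sum_le_sum_of_subset_of_nonneg (fun j hj => ?_) fun _ _ _ => by positivity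
    exact Finset.mem_range_succ_iff.2 (Finset.le_max' _ j hj)

theorem sum_powerset_filter_binomCDF_le {ι : Type*} (I : Finset ι) {θ δ : ℝ}
    (hθ : θ ∈ Set.Icc (0 : ℝ) 1) (hδ : 0 ≤ δ) :
    ∑ J ∈ I.powerset with binomCDF #J #I θ ≤ δ, θ ^ #J * (1 - θ) ^ (#I - #J) ≤ δ := by
  rw [Finset.sum_filter, Finset.sum_powerset_apply_card
    (fun j => if binomCDF j #I θ ≤ δ then θ ^ j * (1 - θ) ^ (#I - j) else 0)]
  simp only [smul_ite, smul_zero, nsmul_eq_mul, ← mul_assoc, ← Finset.sum_filter]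
  exact sum_choose_mul_filter_binomCDF_le #I hθ hδ

theorem prod_ite_mem_ite_mem {ι M : Type*} [Fintype ι] [DecidableEq ι] [CommMonoid M]
    {I J : Finset ι} (hJI : J ⊆ I) (x y z : M) :
    ∏ i, (if i ∈ I then if i ∈ J then x else y else z) =
      x ^ #J * y ^ (#I - #J) * z ^ (Fintype.card ι - #I) := by
  have hI : ∏ i ∈ I, (if i ∈ J then x else y) = x ^ #J * y ^ (#I - #J) := by
    rw [Finset.prod_ite, Finset.prod_const, Finset.prod_const, Finset.filter_mem_eq_inter,
      Finset.inter_eq_right.2 hJI, ← Finset.sdiff_eq_filter, Finset.card_sdiff_of_subset hJI]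
  rw [Finset.prod_ite, Finset.filter_univ_mem, hI, Finset.prod_const, ← Finset.compl_filter,
    Finset.card_compl, Finset.filter_univ_mem]

variable {ι Ω : Type*}

open Classical in
/-- For `J ⊆ I`, the event that the sample points in the acceptance region `A` are those with
index in `I`, and that the ones in `A ∩ E` are those with index in `J`. It is a product set, so
that its probability under an i.i.d. law factorizes. -/
def acceptancePattern (A E : Set Ω) (I J : Finset ι) : Set (ι → Ω) :=
  Set.univ.pi fun i => if i ∈ I then if i ∈ J then A ∩ E else A \ E else Aᶜ

variable [Fintype ι]

open Classical in
theorem mem_acceptancePattern (A E : Set Ω) (ω : ι → Ω) :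
    ω ∈ acceptancePattern A E {i | ω i ∈ A} {i | ω i ∈ A ∧ ω i ∈ E} := by
  intro i _
  simp only [Finset.mem_filter_univ]
  split_ifs with hA hAE
  exacts [hAE, ⟨hA, fun hE => hAE ⟨hA, hE⟩⟩, hA]

variable [MeasurableSpace Ω] (ν : Measure Ω) [IsProbabilityMeasure ν] {A E : Set Ω}

theorem measureReal_acceptancePattern (hA : MeasurableSet A) (hE : MeasurableSet E)
    {I J : Finset ι} (hJI : J ⊆ I) :
    (Measure.pi fun _ : ι => ν).real (acceptancePattern A E I J) =
      ν.real A ^ #I * (1 - ν.real A) ^ (Fintype.card ι - #I) *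
        (ν[|A].real E ^ #J * (1 - ν[|A].real E) ^ (#I - #J)) := by
  classical
  have hinter : ν.real (A ∩ E) = ν.real A * ν[|A].real E := by
    simp only [measureReal_def, ← cond_mul_eq_inter hA E ν, ENNReal.toReal_mul, mul_comm]
  have hdiff : ν.real (A \ E) = ν.real A * (1 - ν[|A].real E) := by
    linarith [measureReal_inter_add_sdiff (μ := ν) (s := A) hE]
  calc (Measure.pi fun _ : ι => ν).real (acceptancePattern A E I J)
      = ∏ i, ν.real (if i ∈ I then if i ∈ J then A ∩ E else A \ E else Aᶜ) := by
        simp only [measureReal_def, acceptancePattern, Measure.pi_pi, ENNReal.toReal_prod]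
    _ = ν.real (A ∩ E) ^ #J * ν.real (A \ E) ^ (#I - #J) *
          ν.real Aᶜ ^ (Fintype.card ι - #I) := by
        simp only [apply_ite ν.real, prod_ite_mem_ite_mem hJI]
    _ = ν.real A ^ (#J + (#I - #J)) * (1 - ν.real A) ^ (Fintype.card ι - #I) *
          (ν[|A].real E ^ #J * (1 - ν[|A].real E) ^ (#I - #J)) := by
        rw [hinter, hdiff, probReal_compl_eq_one_sub hA, mul_pow, mul_pow]
        ring
    _ = _ := by rw [Nat.add_sub_of_le (Finset.card_le_card hJI)]

open Classical in
theorem measureReal_pi_binomCDF_cond_le (hA : MeasurableSet A) (hE : MeasurableSet E) {δ : ℝ}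
    (hδ : 0 ≤ δ) :
    (Measure.pi fun _ : ι => ν).real {ω | binomCDF #{i | ω i ∈ A ∧ ω i ∈ E} #{i | ω i ∈ A}
      (ν[|A].real E) ≤ δ} ≤ δ := by
  set θ := ν[|A].real E
  have hθ : θ ∈ Set.Icc (0 : ℝ) 1 := ⟨measureReal_nonneg, measureReal_le_one⟩
  have ha : 0 ≤ 1 - ν.real A := sub_nonneg.2 measureReal_le_one
  let rejecting (I : Finset ι) : Finset (Finset ι) := {J ∈ I.powerset | binomCDF #J #I θ ≤ δ}
  calc (Measure.pi fun _ : ι => ν).real {ω | binomCDF #{i | ω i ∈ A ∧ ω i ∈ E}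
        #{i | ω i ∈ A} θ ≤ δ}
      ≤ (Measure.pi fun _ : ι => ν).real (⋃ I ∈ (Finset.univ : Finset (Finset ι)),
          ⋃ J ∈ rejecting I, acceptancePattern A E I J) := by
        refine measureReal_mono (fun ω hω => ?_) (measure_ne_top _ _)
        refine Set.mem_biUnion (Finset.mem_univ _)
          (Set.mem_biUnion ?_ (mem_acceptancePattern A E ω))
        refine Finset.mem_filter.2 ⟨Finset.mem_powerset.2 ?_, hω⟩
        exact Finset.monotone_filter_right _ fun _ _ h => h.1
    _ ≤ ∑ I : Finset ι, ∑ J ∈ rejecting I,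
          (Measure.pi fun _ : ι => ν).real (acceptancePattern A E I J) :=
        (measureReal_biUnion_finset_le _ _).trans
          (Finset.sum_le_sum fun I _ => measureReal_biUnion_finset_le _ _)
    _ = ∑ I : Finset ι, ν.real A ^ #I * (1 - ν.real A) ^ (Fintype.card ι - #I) *
          ∑ J ∈ rejecting I, θ ^ #J * (1 - θ) ^ (#I - #J) := by
        refine Finset.sum_congr rfl fun I _ => ?_
        rw [Finset.mul_sum]
        refine Finset.sum_congr rfl fun J hJ => measureReal_acceptancePattern ν hA hE ?_
        exact Finset.mem_powerset.1 (Finset.mem_filter.1 hJ).1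
    _ ≤ ∑ I : Finset ι, ν.real A ^ #I * (1 - ν.real A) ^ (Fintype.card ι - #I) * δ := by
        gcongr with I
        exact sum_powerset_filter_binomCDF_le I hθ hδ
    _ = δ := by
        rw [← Finset.sum_mul, Fintype.sum_pow_mul_eq_add_pow, add_sub_cancel, one_pow, one_mul]

end ConditionalBinomialTest

section RejectionSampling

theorem map_fst_restrict_prod {α β : Type*} [MeasurableSpace α] [MeasurableSpace β]
    (μ : Measure α) (ν : Measure β) [SFinite ν] {s : Set (α × β)} (hs : MeasurableSet s) :
    ((μ.prod ν).restrict s).map Prod.fst = μ.withDensity fun x => ν (Prod.mk x ⁻¹' s) := by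
  ext t ht
  rw [Measure.map_apply measurable_fst ht, Measure.restrict_apply (measurable_fst ht),
    Measure.prod_apply ((measurable_fst ht).inter hs), withDensity_apply _ ht,
    ← lintegral_indicator ht]
  refine lintegral_congr fun x => ?_
  rw [Set.preimage_inter, ← Set.preimage_comp]
  by_cases hx : x ∈ t <;> simp [hx, Function.comp_def]

instance : IsProbabilityMeasure uniform01 := ⟨by simp [uniform01]⟩

theorem uniform01_Iic {c : ℝ} (hc : c ≤ 1) : uniform01 (Set.Iic c) = ENNReal.ofReal c := by
  rw [uniform01, Measure.restrict_apply measurableSet_Iic, ← Set.Ici_inter_Iic,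
    Set.inter_left_comm, Set.Iic_inter_Iic, min_eq_left hc, Set.Ici_inter_Iic, Real.volume_Icc,
    sub_zero]

variable {Ω : Type*}

/-- The event that rejection sampling with weight `w`, bounded by `b`, accepts the proposal `u.1`
given the uniform variable `u.2`. -/
def acceptRegion (w : Ω → ℝ) (b : ℝ) : Set (Ω × ℝ) := {u | u.2 ≤ w u.1 / b}

variable [MeasurableSpace Ω] {P Q : Measure Ω} [IsProbabilityMeasure Q] {w : Ω → ℝ} {b : ℝ}

theorem measurableSet_acceptRegion (hw : Measurable w) (b : ℝ) :
    MeasurableSet (acceptRegion w b) :=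
  measurableSet_le measurable_snd (by fun_prop)

theorem pos_of_eq_withDensity_of_le (hQ : Q = P.withDensity fun z => ENNReal.ofReal (w z))
    (hb : ∀ z, w z ≤ b) : 0 < b := by
  by_contra! h
  have hzero : (fun z => ENNReal.ofReal (w z)) = 0 :=
    funext fun z => ENNReal.ofReal_of_nonpos ((hb z).trans h)
  rw [hzero, withDensity_zero] at hQ
  exact IsProbabilityMeasure.ne_zero Q hQ

theorem map_fst_restrict_acceptRegion (hw : Measurable w) (hb : ∀ z, w z ≤ b)
    (hQ : Q = P.withDensity fun z => ENNReal.ofReal (w z)) :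
    ((P.prod uniform01).restrict (acceptRegion w b)).map Prod.fst = ENNReal.ofReal b⁻¹ • Q := by
  have hb0 : 0 < b := pos_of_eq_withDensity_of_le hQ hb
  rw [map_fst_restrict_prod _ _ (measurableSet_acceptRegion hw b), hQ,
    ← withDensity_smul _ hw.ennreal_ofReal]
  congr 1
  ext z
  calc uniform01 (Prod.mk z ⁻¹' acceptRegion w b)
      = ENNReal.ofReal (w z / b) := uniform01_Iic ((div_le_one hb0).2 (hb z))
    _ = ENNReal.ofReal b⁻¹ * ENNReal.ofReal (w z) := by
        rw [div_eq_inv_mul, ENNReal.ofReal_mul (inv_nonneg.2 hb0.le)]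

theorem map_fst_cond_acceptRegion (hw : Measurable w) (hb : ∀ z, w z ≤ b)
    (hQ : Q = P.withDensity fun z => ENNReal.ofReal (w z)) :
    ((P.prod uniform01)[|acceptRegion w b]).map Prod.fst = Q := by
  have hb0 : 0 < b := pos_of_eq_withDensity_of_le hQ hb
  have hmap := map_fst_restrict_acceptRegion hw hb hQ
  have hmass : (P.prod uniform01) (acceptRegion w b) = ENNReal.ofReal b⁻¹ := by
    have := congrArg (fun μ => μ Set.univ) hmap
    simpa [Measure.map_apply measurable_fst MeasurableSet.univ] using this
  rw [ProbabilityTheory.cond, Measure.map_smul, hmap, hmass, smul_smul,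
    ENNReal.inv_mul_cancel (by simpa using hb0) ENNReal.ofReal_ne_top, one_smul]

open Classical in
theorem measureReal_pi_binomCDF_acceptRegion_le [IsProbabilityMeasure P] (hw : Measurable w)
    (hb : ∀ z, w z ≤ b) (hQ : Q = P.withDensity fun z => ENNReal.ofReal (w z)) {E : Set Ω}
    (hE : MeasurableSet E) {δ : ℝ} (hδ : 0 ≤ δ) (ι : Type*) [Fintype ι] :
    (Measure.pi fun _ : ι => P.prod uniform01).real
      {u | binomCDF #{i | (u i).2 ≤ w (u i).1 / b ∧ (u i).1 ∈ E}
        #{i | (u i).2 ≤ w (u i).1 / b} (Q.real E) ≤ δ} ≤ δ := by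
  have hcond : (P.prod uniform01)[|acceptRegion w b].real (Prod.fst ⁻¹' E) = Q.real E := by
    rw [← map_measureReal_apply measurable_fst hE, map_fst_cond_acceptRegion hw hb hQ]
  rw [← hcond]
  exact measureReal_pi_binomCDF_cond_le (P.prod uniform01) (measurableSet_acceptRegion hw b)
    (measurable_fst hE) hδ

end RejectionSampling

section CovariateShift

variable {X Y : Type*} [MeasurableSpace X] [MeasurableSpace Y]

theorem measurable_importanceWeight {p q : X → ℝ≥0} (hp : Measurable p) (hq : Measurable q) :
    Measurable (importanceWeight p q) := by
  unfold importanceWeight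
  fun_prop

theorem withDensity_importanceWeight {μ : Measure X} {p q : X → ℝ≥0} (hp : Measurable p)
    (hq : Measurable q) (hpq : ∀ x, p x = 0 → q x = 0) :
    (μ.withDensity fun x => (p x : ℝ≥0∞)).withDensity
      (fun x => ENNReal.ofReal (importanceWeight p q x)) = μ.withDensity fun x => (q x : ℝ≥0∞) := by
  rw [← withDensity_mul _ (by fun_prop) (measurable_importanceWeight hp hq).ennreal_ofReal]
  congr 1
  ext x
  rw [Pi.mul_apply, importanceWeight, ← NNReal.coe_div, ENNReal.ofReal_coe_nnreal,
    ← ENNReal.coe_mul, mul_div_cancel_of_imp' (hpq x)]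

theorem withDensity_compProd (μ : Measure X) [SFinite μ] (κ : Kernel X Y) [IsSFiniteKernel κ]
    {w : X → ℝ≥0∞} (hw : Measurable w) :
    μ.withDensity w ⊗ₘ κ = (μ ⊗ₘ κ).withDensity fun z => w z.1 := by
  ext s hs
  rw [Measure.compProd_apply hs, lintegral_withDensity_eq_lintegral_mul _ hw
    (Kernel.measurable_kernel_prodMk_left hs), withDensity_apply _ hs, ← lintegral_indicator hs,
    Measure.lintegral_compProd (Measurable.indicator (by fun_prop) hs)]
  exact lintegral_congr fun x =>
    (lintegral_indicator_const (measurable_prodMk_left hs) (w x)).symm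

theorem eq_withDensity_comp_fst {P Q : Measure (X × Y)} [SFinite P] (κ : Kernel X Y)
    [IsSFiniteKernel κ] [P.IsCondKernel κ] [Q.IsCondKernel κ] {w : X → ℝ≥0∞} (hw : Measurable w)
    (hQ : Q.fst = P.fst.withDensity w) : Q = P.withDensity fun z => w z.1 := by
  calc Q = Q.fst ⊗ₘ κ := Q.disintegrate κ |>.symm
    _ = (P.fst ⊗ₘ κ).withDensity fun z => w z.1 := by rw [hQ, withDensity_compProd _ _ hw]
    _ = P.withDensity fun z => w z.1 := by rw [P.disintegrate κ]

end CovariateShift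

section GreedyThreshold

variable {X Y : Type*} {m : ℕ} {S : Fin m → X × Y} {V lo hi w : Fin m → ℝ} {b δ ε : ℝ}

open Classical in
theorem uRSCP_eq_cpUpper (C : X → Set Y) (S : Fin m → X × Y) (V w : Fin m → ℝ) (b δ : ℝ) :
    uRSCP C S V w b δ =
      cpUpper #{i | V i ≤ w i / b ∧ (S i).2 ∉ C (S i).1} #{i | V i ≤ w i / b} δ := by
  rw [uRSCP, uCP, errorCount, acceptedSample, Multiset.countP_map, Multiset.card_map,
    ← Finset.filter_val, Finset.filter_filter, Finset.card_val, Finset.card_val]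

theorem uRSCP_greedyWeights_congr {C C' : X → Set Y}
    (h : ∀ i, (S i).2 ∈ C (S i).1 ↔ (S i).2 ∈ C' (S i).1) :
    uRSCP C S V (greedyWeights C S lo hi) b δ = uRSCP C' S V (greedyWeights C' S lo hi) b δ := by
  classical
  have hweights : greedyWeights C S lo hi = greedyWeights C' S lo hi :=
    funext fun i => if_congr (not_congr (h i)) rfl rfl
  rw [uRSCP_eq_cpUpper, uRSCP_eq_cpUpper, hweights]
  simp only [h]

theorem uRSCP_eq_one_of_forall_notMem {C : X → Set Y} (h : ∀ i, (S i).2 ∉ C (S i).1)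
    (hδ : δ < 1) : uRSCP C S V w b δ = 1 := by
  simp only [uRSCP_eq_cpUpper, h, not_false_eq_true, and_true, cpUpper_self _ hδ]

theorem uRSCP_le_uRSCP_greedyWeights (C : X → Set Y) (S : Fin m → X × Y) (V : Fin m → ℝ)
    (hb : 0 ≤ b) (δ : ℝ) (hw : w ∈ uncertaintyBox lo hi) :
    uRSCP C S V w b δ ≤ uRSCP C S V (greedyWeights C S lo hi) b δ := by
  classical
  set g := greedyWeights C S lo hi
  have herr : #{i | V i ≤ w i / b ∧ (S i).2 ∉ C (S i).1} ≤
      #{i | V i ≤ g i / b ∧ (S i).2 ∉ C (S i).1} :=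
    Finset.card_le_card <| Finset.monotone_filter_right _ fun i _ ⟨hV, hC⟩ =>
      ⟨hV.trans (div_le_div_of_nonneg_right ((hw i).2.trans_eq (if_pos hC).symm) hb), hC⟩
  have hcorrect : #{i | V i ≤ g i / b ∧ ¬ (S i).2 ∉ C (S i).1} ≤
      #{i | V i ≤ w i / b ∧ ¬ (S i).2 ∉ C (S i).1} :=
    Finset.card_le_card <| Finset.monotone_filter_right _ fun i _ ⟨hV, hC⟩ =>
      ⟨hV.trans (div_le_div_of_nonneg_right ((if_neg hC).trans_le (hw i).1) hb), hC⟩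
  have hsplit (v : Fin m → ℝ) : #{i | V i ≤ v i / b} =
      #{i | V i ≤ v i / b ∧ (S i).2 ∉ C (S i).1} +
        #{i | V i ≤ v i / b ∧ ¬ (S i).2 ∉ C (S i).1} := by
    rw [← Finset.filter_filter, ← Finset.filter_filter, Finset.card_filter_add_card_filter_not]
  rw [uRSCP_eq_cpUpper, uRSCP_eq_cpUpper, hsplit w, hsplit g]
  exact cpUpper_add_le_cpUpper_add herr hcorrect δ

open Classical in
theorem binomCDF_le_of_uRSCP_le {C : X → Set Y} {E : Set (X × Y)} {θ : ℝ}
    (h : uRSCP C S V w b δ ≤ ε) (hE : E ⊆ {z | z.2 ∉ C z.1}) (hε : ε ∈ Set.Ico (0 : ℝ) 1)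
    (hεθ : ε ≤ θ) (hθ : θ ≤ 1) :
    binomCDF #{i | V i ≤ w i / b ∧ S i ∈ E} #{i | V i ≤ w i / b} θ ≤ δ := by
  rw [uRSCP_eq_cpUpper] at h
  refine le_trans ?_ (binomCDF_le_of_cpUpper_le h hε.2 hεθ hθ)
  refine monotone_binomCDF_left _ ⟨hε.1.trans hεθ, hθ⟩ (Finset.card_le_card ?_)
  exact Finset.monotone_filter_right _ fun _ _ hi => ⟨hi.1, hE hi.2⟩

variable {f : X × Y → ℝ≥0} {τ : ℝ≥0}

theorem notMem_predSet_iff (f : X × Y → ℝ≥0) (τ : ℝ≥0) (z : X × Y) :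
    z.2 ∉ predSet f τ z.1 ↔ f z < τ := by
  simp [predSet]

theorem exists_le_score_and_score_mem_feasible (hδ : δ < 1) (hε : ε < 1)
    (hτ : τ ∈ feasible f S V lo hi b δ ε) :
    ∃ i, τ ≤ f (S i) ∧ f (S i) ∈ feasible f S V lo hi b δ ε := by
  have hne : ({i | τ ≤ f (S i)} : Set (Fin m)).Nonempty := by
    by_contra! hempty
    have hone := uRSCP_eq_one_of_forall_notMem (V := V) (b := b) (C := predSet f τ)
      (w := greedyWeights (predSet f τ) S lo hi) (Set.eq_empty_iff_forall_notMem.1 hempty) hδ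
    exact hε.not_ge (hone.symm.trans_le hτ)
  obtain ⟨i, hi, hmin⟩ := Set.exists_min_image _ (fun i => f (S i)) (Set.toFinite _) hne
  refine ⟨i, hi, (uRSCP_greedyWeights_congr fun j => ?_).trans_le hτ⟩
  change f (S i) ≤ f (S j) ↔ τ ≤ f (S j)
  exact ⟨le_trans hi, hmin j⟩

theorem isGreatest_tauHat (hδ : δ < 1) (hε : ε < 1)
    (hne : (feasible f S V lo hi b δ ε).Nonempty) :
    IsGreatest (feasible f S V lo hi b δ ε) (tauHat f S V lo hi b δ ε) := by
  have hscores : (feasible f S V lo hi b δ ε ∩ Set.range fun i => f (S i)).Nonempty := by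
    obtain ⟨τ, hτ⟩ := hne
    obtain ⟨i, -, hi⟩ := exists_le_score_and_score_mem_feasible hδ hε hτ
    exact ⟨f (S i), hi, i, rfl⟩
  obtain ⟨t, ht, hmax⟩ := Set.exists_max_image _ id ((Set.finite_range _).inter_of_right _) hscores
  have hgreatest : IsGreatest (feasible f S V lo hi b δ ε) t := by
    refine ⟨ht.1, fun τ hτ => ?_⟩
    obtain ⟨i, hτi, hi⟩ := exists_le_score_and_score_mem_feasible hδ hε hτ
    exact hτi.trans (hmax _ ⟨hi, i, rfl⟩)
  rwa [tauHat, hgreatest.csSup_eq]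

theorem tauHat_mem_feasible (hδ : δ < 1) (hε : ε < 1) (hpos : 0 < tauHat f S V lo hi b δ ε) :
    tauHat f S V lo hi b δ ε ∈ feasible f S V lo hi b δ ε := by
  refine (isGreatest_tauHat hδ hε ?_).1
  by_contra! hempty
  simp [tauHat, hempty] at hpos

end GreedyThreshold

section CriticalSet

variable {Ω : Type*} [MeasurableSpace Ω]

/-- A critical set at level `ε` for the score `f`: a common part, of mass at least `ε`, of all the
sublevel sets `{z | f z < τ}` of mass greater than `ε`. It stands for all the invalid thresholds
`τ` at once. If there are none, every set is critical. -/
def IsCriticalSet (Q : Measure Ω) (f : Ω → ℝ≥0) (ε : ℝ) (E : Set Ω) : Prop :=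
  ∀ τ, ε < Q.real {z | f z < τ} → ε ≤ Q.real E ∧ E ⊆ {z | f z < τ}

theorem le_measureReal_le_of_forall_gt {Q : Measure Ω} [IsFiniteMeasure Q] {f : Ω → ℝ≥0}
    (hf : Measurable f) {ε : ℝ} {t : ℝ≥0} (h : ∀ τ > t, ε ≤ Q.real {z | f z < τ}) :
    ε ≤ Q.real {z | f z ≤ t} := by
  have hinter : {z | f z ≤ t} = ⋂ τ > t, {z | f z < τ} := by
    ext z
    simp only [Set.mem_ofPred_eq, Set.mem_iInter]
    exact ⟨fun hz τ hτ => hz.trans_lt hτ, le_of_forall_gt⟩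
  have hlim := tendsto_measure_biInter_gt (μ := Q) (s := fun τ => {z | f z < τ}) (a := t)
    (fun τ _ => (measurableSet_lt hf measurable_const).nullMeasurableSet)
    (fun _ _ _ hij z hz => lt_of_lt_of_le hz hij) ⟨t + 1, by simp, measure_ne_top _ _⟩
  rw [← hinter] at hlim
  refine ge_of_tendsto ((ENNReal.tendsto_toReal (measure_ne_top Q _)).comp hlim) ?_
  filter_upwards [self_mem_nhdsWithin] with τ hτ using h τ hτ

theorem exists_isCriticalSet (Q : Measure Ω) [IsFiniteMeasure Q] {f : Ω → ℝ≥0}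
    (hf : Measurable f) (ε : ℝ) : ∃ E, MeasurableSet E ∧ IsCriticalSet Q f ε E := by
  set A : Set ℝ≥0 := {τ | ε < Q.real {z | f z < τ}}
  have hle : ∀ τ ∈ A, sInf A ≤ τ := fun τ hτ => csInf_le' hτ
  by_cases hmem : sInf A ∈ A
  · exact ⟨{z | f z < sInf A}, measurableSet_lt hf measurable_const, fun τ hτ =>
      ⟨hmem.le, fun z hz => lt_of_lt_of_le hz (hle τ hτ)⟩⟩
  refine ⟨{z | f z ≤ sInf A}, measurableSet_le hf measurable_const, fun τ₀ hτ₀ => ⟨?_, ?_⟩⟩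
  · refine le_measureReal_le_of_forall_gt hf fun τ hτ => ?_
    obtain ⟨σ, hσ, hστ⟩ := exists_lt_of_csInf_lt ⟨τ₀, hτ₀⟩ hτ
    exact hσ.le.trans (measureReal_mono fun z hz => lt_trans hz hστ)
  · exact fun z hz => lt_of_le_of_lt hz ((hle τ₀ hτ₀).lt_of_ne fun h => hmem (h ▸ hτ₀))

end CriticalSet

section Coverage

variable {X Y : Type*} [MeasurableSpace X] [MeasurableSpace Y]

theorem expectedError_predSet (Q : Measure (X × Y)) (f : X × Y → ℝ≥0) (τ : ℝ≥0) :
    expectedError Q (predSet f τ) = Q.real {z | f z < τ} := by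
  simp only [expectedError, notMem_predSet_iff]

open Classical in
theorem expectedError_le_of_le_tauHat {Q : Measure (X × Y)} [IsProbabilityMeasure Q]
    {f : X × Y → ℝ≥0} {E : Set (X × Y)} {m : ℕ} {S : Fin m → X × Y} {V lo hi w : Fin m → ℝ}
    {b δ ε : ℝ} {τ : ℝ≥0} (hE : IsCriticalSet Q f ε E) (hb : 0 ≤ b) (hδ : δ < 1)
    (hε : ε ∈ Set.Ico (0 : ℝ) 1) (hw : w ∈ uncertaintyBox lo hi)
    (hreject : δ < binomCDF #{i | V i ≤ w i / b ∧ S i ∈ E} #{i | V i ≤ w i / b} (Q.real E))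
    (hτ : τ ≤ tauHat f S V lo hi b δ ε) : expectedError Q (predSet f τ) ≤ ε := by
  by_contra! hinvalid
  rw [expectedError_predSet] at hinvalid
  have hpos : 0 < τ := by
    by_contra! h0
    simp only [nonpos_iff_eq_zero.1 h0, not_lt_zero, Set.ofPred_false, measureReal_empty]
      at hinvalid
    exact hinvalid.not_ge hε.1
  obtain ⟨hεE, hEτ⟩ := hE τ hinvalid
  have hEerr : E ⊆ {z | z.2 ∉ predSet f (tauHat f S V lo hi b δ ε) z.1} := fun z hz =>
    (notMem_predSet_iff f _ z).2 (lt_of_lt_of_le (hEτ hz) hτ)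
  have hfeasible := tauHat_mem_feasible hδ hε.2 (hpos.trans_le hτ)
  have htrue : uRSCP (predSet f (tauHat f S V lo hi b δ ε)) S V w b δ ≤ ε :=
    (uRSCP_le_uRSCP_greedyWeights _ S V hb δ hw).trans hfeasible
  exact hreject.not_ge (binomCDF_le_of_uRSCP_le htrue hEerr hε hεE measureReal_le_one)

theorem measurableSet_mem_uncertaintyBox {α : Type*} [MeasurableSpace α] {m : ℕ}
    {w lo hi : α → Fin m → ℝ} (hw : Measurable w) (hlo : Measurable lo) (hhi : Measurable hi) :
    MeasurableSet {a | w a ∈ uncertaintyBox (lo a) (hi a)} := by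
  simp only [uncertaintyBox, Set.mem_ofPred_eq]
  measurability

variable (P Q : Measure (X × Y)) [IsProbabilityMeasure P] [IsProbabilityMeasure Q]

instance (m n : ℕ) : IsProbabilityMeasure (dataLaw P Q m n) := by
  unfold dataLaw
  infer_instance

theorem measurePreserving_dataLaw_labeled (m n : ℕ) :
    MeasurePreserving
      (fun (ω : (Fin m → X × Y) × (Fin m → ℝ) × (Fin n → X)) i => (ω.1 i, ω.2.1 i))
      (dataLaw P Q m n) (Measure.pi fun _ : Fin m => P.prod uniform01) :=
  (measurePreserving_arrowProdEquivProdArrow (X × Y) ℝ (Fin m) (fun _ => P)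
    (fun _ => uniform01)).symm.comp ((MeasurePreserving.id _).prod measurePreserving_fst)

theorem measurePreserving_dataLaw_unlabeled (m n : ℕ) :
    MeasurePreserving
      (fun ω : (Fin m → X × Y) × (Fin m → ℝ) × (Fin n → X) => (fun i => (ω.1 i).1, ω.2.2))
      (dataLaw P Q m n)
      ((Measure.pi fun _ : Fin m => P.fst).prod (Measure.pi fun _ : Fin n => Q.fst)) :=
  (measurePreserving_pi (fun _ : Fin m => P) (fun _ => P.fst)
    fun _ => ⟨measurable_fst, rfl⟩).prod measurePreserving_snd

variable {P Q}

open Classical in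
theorem dataLaw_real_binomCDF_le {w : X × Y → ℝ} {b δ : ℝ} (hw : Measurable w)
    (hb : ∀ z, w z ≤ b) (hQ : Q = P.withDensity fun z => ENNReal.ofReal (w z)) {E : Set (X × Y)}
    (hE : MeasurableSet E) (hδ : 0 ≤ δ) (m n : ℕ) :
    (dataLaw P Q m n).real
      {ω | binomCDF #{i | ω.2.1 i ≤ w (ω.1 i) / b ∧ ω.1 i ∈ E} #{i | ω.2.1 i ≤ w (ω.1 i) / b}
        (Q.real E) ≤ δ} ≤ δ :=
  (ENNReal.toReal_mono (measure_ne_top _ _)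
    ((measurePreserving_dataLaw_labeled P Q m n).measure_preimage_le _)).trans
    (measureReal_pi_binomCDF_acceptRegion_le hw hb hQ hE hδ (Fin m))

theorem dataLaw_real_notMem_uncertaintyBox_le {m n : ℕ} {w : X → ℝ}
    {lo hi : (Fin m → X) × (Fin n → X) → Fin m → ℝ} {δ : ℝ} (hw : Measurable w)
    (hlo : Measurable lo) (hhi : Measurable hi)
    (hbox : 1 - δ ≤
      ((Measure.pi fun _ : Fin m => P.fst).prod (Measure.pi fun _ : Fin n => Q.fst)).real
        {a | (fun i => w (a.1 i)) ∈ uncertaintyBox (lo a) (hi a)}) :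
    (dataLaw P Q m n).real
      {ω | (fun i => w (ω.1 i).1) ∉ uncertaintyBox (lo (fun i => (ω.1 i).1, ω.2.2))
        (hi (fun i => (ω.1 i).1, ω.2.2))} ≤ δ := by
  have hmeas : MeasurableSet {a : (Fin m → X) × (Fin n → X) |
      (fun i => w (a.1 i)) ∈ uncertaintyBox (lo a) (hi a)} :=
    measurableSet_mem_uncertaintyBox (by fun_prop) hlo hhi
  have hmiss := (measurePreserving_dataLaw_unlabeled P Q m n).measureReal_preimage
    hmeas.compl.nullMeasurableSet
  rw [probReal_compl_eq_one_sub hmeas] at hmiss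
  exact hmiss.trans_le (by linarith)

theorem one_sub_sub_le_measureReal {Ω : Type*} [MeasurableSpace Ω] {μ : Measure Ω}
    [IsProbabilityMeasure μ] {s t u : Set Ω} {δ δ' : ℝ} (ht : μ.real t ≤ δ) (hu : μ.real u ≤ δ')
    (hs : ∀ ω, ω ∉ t → ω ∉ u → ω ∈ s) : 1 - δ - δ' ≤ μ.real s := by
  -- The sets need not be measurable, so the space is covered instead of taking complements.
  have hcover : Set.univ = s ∪ (t ∪ u) := by
    ext ω
    simpa [or_iff_not_imp_right, imp.swap] using hs ω
  have hunion : μ.real (s ∪ (t ∪ u)) = 1 := hcover ▸ probReal_univ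
  linarith [measureReal_union_le (μ := μ) s (t ∪ u), measureReal_union_le (μ := μ) t u]

end Coverage

end CovShift

open CovShift in
theorem theorem4 {X Y : Type*} [MeasurableSpace X] [MeasurableSpace Y]
    -- source and target distributions, with densities `p`, `q` of the covariates
    (P Q : Measure (X × Y)) [IsProbabilityMeasure P] [IsProbabilityMeasure Q]
    (μ : Measure X) (p q : X → ℝ≥0) (hp : Measurable p) (hq : Measurable q)
    (hP : P.fst = μ.withDensity (fun x => (p x : ℝ≥0∞)))
    (hQ : Q.fst = μ.withDensity (fun x => (q x : ℝ≥0∞)))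
    -- covariate shift: a common conditional distribution of the label given the covariate
    (κ : Kernel X Y) [IsMarkovKernel κ] [P.IsCondKernel κ] [Q.IsCondKernel κ]
    -- the importance weights `q / p` are finite and bounded by `b`
    (hpq : ∀ x, p x = 0 → q x = 0)
    (b : ℝ) (hb : ∀ x, importanceWeight p q x ≤ b)
    (f : X × Y → ℝ≥0) (hf : Measurable f)
    (ε δC δw : ℝ) (hε : ε ∈ Set.Ioo 0 1) (hδC : δC ∈ Set.Ioo 0 1) (hδw : δw ∈ Set.Ioo 0 1)
    (m n : ℕ)
    -- the bounds of the box, as functions of the unlabeled source and target samples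
    (lo hi : (Fin m → X) × (Fin n → X) → Fin m → ℝ) (hlo : Measurable lo) (hhi : Measurable hi)
    (hW : 1 - δw ≤
      ((Measure.pi fun _ : Fin m => P.fst).prod (Measure.pi fun _ : Fin n => Q.fst)).real
        {a | (fun i => importanceWeight p q (a.1 i)) ∈ uncertaintyBox (lo a) (hi a)}) :
    -- the maximum that defines the threshold is attained whenever the problem is feasible
    (∀ (S : Fin m → X × Y) (V : Fin m → ℝ) (T : Fin n → X),
      let l := lo (fun i => (S i).1, T)
      let h := hi (fun i => (S i).1, T)
      (feasible f S V l h b δC ε).Nonempty →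
        IsGreatest (feasible f S V l h b δC ε) (tauHat f S V l h b δC ε)) ∧
    1 - δC - δw ≤ (dataLaw P Q m n).real
      {ω | ∀ τ : ℝ≥0,
        τ ≤ tauHat f ω.1 ω.2.1 (lo (fun i => (ω.1 i).1, ω.2.2)) (hi (fun i => (ω.1 i).1, ω.2.2))
          b δC ε →
        expectedError Q (predSet f τ) ≤ ε} := by
  refine ⟨fun S V T => isGreatest_tauHat hδC.2 hε.2, ?_⟩
  have hw : Measurable (importanceWeight p q) := measurable_importanceWeight hp hq
  have hfst : Q.fst = P.fst.withDensity fun x => ENNReal.ofReal (importanceWeight p q x) := by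
    rw [hP, hQ, withDensity_importanceWeight hp hq hpq]
  have hdens := eq_withDensity_comp_fst κ hw.ennreal_ofReal hfst
  have hwb : ∀ z : X × Y, importanceWeight p q z.1 ≤ b := fun z => hb z.1
  obtain ⟨E, hE, hcritical⟩ := exists_isCriticalSet Q hf ε
  have haccept := dataLaw_real_binomCDF_le (hw.comp measurable_fst) hwb hdens hE hδC.1.le m n
  have hmiss := dataLaw_real_notMem_uncertaintyBox_le hw hlo hhi hW
  refine one_sub_sub_le_measureReal haccept hmiss fun ω hreject hbox τ hτ => ?_
  exact expectedError_le_of_le_tauHat hcritical (pos_of_eq_withDensity_of_le hdens hwb).le hδC.2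
    ⟨hε.1.le, hε.2⟩ (not_not.1 hbox) (not_le.1 hreject) hτ
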